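/- A partition is a weakly decreasing sequence $\lambda=(\lambda_1\ge\lambda_2\ge\cdots)$ of nonnegative integers, eventually $0$, of size $|\lambda|=\sum_i\lambda_i$; the sum of two partitions is $(\lambda+\mu)_i=\lambda_i+\mu_i$, and $d$-tuples of partitions are added coordinatewise. For a partition $\lambda$ of $m$ let $[\lambda]$ be the Specht module of the symmetric group $S_m$ over $\mathbb{C}$, i.e. the irreducible representation indexed by $\lambda$. For a $d$-tuple $\boldsymbol{\lambda}=(\lambda^{(1)},\ldots,\lambda^{(d)})$ of partitions of $m$, the generalized Kronecker coefficient $g(\boldsymbol{\lambda})$ is the multiplicity of the trivial representation of $S_m$ in $[\lambda^{(1)}]\otimes\cdots\otimes[\lambda^{(d)}]$ with the diagonal action of $S_m$ (an empty tensor product is the trivial representation). **Corollary (Semigroup property).** Let $d,m_1,m_2\ge 0$ be integers, let $\boldsymbol{\lambda}$ be a $d$-tuple of partitions of $m_1$ and $\boldsymbol{\mu}$ a $d$-tuple of partitions of $m_2$. If $g(\boldsymbol{\lambda})\cdot g(\boldsymbol{\mu})>0$, then $$g(\boldsymbol{\lambda}+\boldsymbol{\mu})\ \ge\ \max\bigl(g(\boldsymbol{\lambda}),\,g(\boldsymbol{\mu})\bigr).$$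 -/

import Mathlib

/-! Partitions are represented by their Young diagrams (`YoungDiagram`, boxes `(i, j)` with row
index `i` and column index `j` starting at `0`); the parts of `lam` are the row lengths
`lam.rowLen 0 ≥ lam.rowLen 1 ≥ …`, and `lam` is a partition of `m` iff `lam.card = m`. -/

/-- The sum `lam + mu` of two partitions: parts are added, `(lam + mu)_i = lam_i + mu_i`. -/
def YoungDiagram.addRows (lam mu : YoungDiagram) : YoungDiagram where
  cells := (Finset.range (lam.colLen 0 + mu.colLen 0) ×ˢ
      Finset.range (lam.rowLen 0 + mu.rowLen 0)).filter
    fun c => c.2 < lam.rowLen c.1 + mu.rowLen c.1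
  isLowerSet := by
    rintro ⟨i, j⟩ ⟨i', j'⟩ ⟨hi, hj⟩ h
    have h1 := lam.rowLen_anti _ _ hi
    have h2 := mu.rowLen_anti _ _ hi
    simp only [Finset.coe_filter, Finset.mem_product, Finset.mem_range, Set.mem_ofPred_eq] at *
    omega

theorem YoungDiagram.mem_addRows {lam mu : YoungDiagram} {c : ℕ × ℕ} :
    c ∈ lam.addRows mu ↔ c.2 < lam.rowLen c.1 + mu.rowLen c.1 := by
  rw [← YoungDiagram.mem_cells]
  simp only [YoungDiagram.addRows, Finset.mem_filter, Finset.mem_product, Finset.mem_range,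
    and_iff_right_iff_imp]
  intro h
  have h1 := lam.rowLen_anti 0 c.1 (Nat.zero_le _)
  have h2 := mu.rowLen_anti 0 c.1 (Nat.zero_le _)
  have h3 : 0 < lam.rowLen c.1 → c.1 < lam.colLen 0 := fun h =>
    YoungDiagram.mem_iff_lt_colLen.1 (YoungDiagram.mem_iff_lt_rowLen.2 h)
  have h4 : 0 < mu.rowLen c.1 → c.1 < mu.colLen 0 := fun h =>
    YoungDiagram.mem_iff_lt_colLen.1 (YoungDiagram.mem_iff_lt_rowLen.2 h)
  omega

theorem YoungDiagram.rowLen_addRows (lam mu : YoungDiagram) (i : ℕ) :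
    (lam.addRows mu).rowLen i = lam.rowLen i + mu.rowLen i := by
  refine le_antisymm (not_lt.1 fun h => ?_) (not_lt.1 fun h => ?_)
  · have := YoungDiagram.mem_addRows.1 (YoungDiagram.mem_iff_lt_rowLen.2 h)
    exact lt_irrefl _ this
  · have := YoungDiagram.mem_iff_lt_rowLen.1
      ((YoungDiagram.mem_addRows (lam := lam) (mu := mu)
        (c := (i, (lam.addRows mu).rowLen i))).2 h)
    exact lt_irrefl _ this

theorem YoungDiagram.card_eq_sum_rowLen (lam : YoungDiagram) {N : ℕ} (h : lam.colLen 0 ≤ N) :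
    lam.card = ∑ i ∈ Finset.range N, lam.rowLen i := by
  have hmap : Set.MapsTo Prod.fst (lam.cells : Set (ℕ × ℕ)) (Finset.range N : Set ℕ) := by
    intro c hc
    have h1 : (c.1, c.2) ∈ lam := hc
    have h2 := YoungDiagram.mem_iff_lt_colLen.1 h1
    have h3 := lam.colLen_anti 0 c.2 (Nat.zero_le _)
    exact Finset.mem_coe.2 (Finset.mem_range.2 (by omega))
  rw [YoungDiagram.card, Finset.card_eq_sum_card_fiberwise hmap]
  exact Finset.sum_congr rfl fun i _ => (lam.rowLen_eq_card).symm

/-- The sum of a partition of `m₁` and a partition of `m₂` is a partition of `m₁ + m₂`. -/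
theorem YoungDiagram.card_addRows (lam mu : YoungDiagram) :
    (lam.addRows mu).card = lam.card + mu.card := by
  rw [(lam.addRows mu).card_eq_sum_rowLen
      (N := (lam.addRows mu).colLen 0 + lam.colLen 0 + mu.colLen 0) (by omega),
    lam.card_eq_sum_rowLen (N := (lam.addRows mu).colLen 0 + lam.colLen 0 + mu.colLen 0)
      (by omega),
    mu.card_eq_sum_rowLen (N := (lam.addRows mu).colLen 0 + lam.colLen 0 + mu.colLen 0)
      (by omega), ← Finset.sum_add_distrib]
  exact Finset.sum_congr rfl fun i _ => YoungDiagram.rowLen_addRows lam mu i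

noncomputable section

open Equiv in
/-- The permutation representation of `S_m` on the complex vector space with basis all words
`w : Fin m → ℕ` of length `m`; `S_m` permutes positions, `(σ w)(k) = w (σ⁻¹ k)`. -/
def wordRep (m : ℕ) : Representation ℂ (Perm (Fin m)) ((Fin m → ℕ) →₀ ℂ) where
  toFun σ := Finsupp.lmapDomain ℂ ℂ fun w => w ∘ ⇑σ⁻¹
  map_one' := by
    ext w : 2
    simp [Finsupp.lmapDomain_apply, Finsupp.mapDomain_single]
  map_mul' σ τ := by
    ext w : 2
    simp [Finsupp.lmapDomain_apply, Finsupp.mapDomain_single, Function.comp_assoc]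

/-- A Young tableau of shape `lam` is a bijection `T` from `[m]` onto the boxes of `lam`
(`T k` is the box that contains the number `k`). -/
abbrev YoungTableau (m : ℕ) (lam : YoungDiagram) : Type := Fin m ≃ lam.cells

namespace YoungTableau

variable {m : ℕ} {lam : YoungDiagram}

/-- The tableau `σ T`, in which every entry `k` of `T` is replaced by `σ k`. -/
def act (σ : Equiv.Perm (Fin m)) (T : YoungTableau m lam) : YoungTableau m lam :=
  σ.symm.trans T

/-- The row word of `T`: its `k`-th letter is the index of the row that contains `k`. Two tableaux
have the same row word iff they differ by a permutation of the entries within rows, so that row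
words encode tabloids. -/
def rowWord (T : YoungTableau m lam) : Fin m → ℕ := fun k => (T k).1.1

/-- The column stabilizer of `T`: the permutations that keep every number in its column. -/
def colStab (T : YoungTableau m lam) : Finset (Equiv.Perm (Fin m)) :=
  Finset.univ.filter fun π => ∀ k, (T (π k)).1.2 = (T k).1.2

/-- The polytabloid `e_T = ∑_{π ∈ C(T)} sgn(π) {π T}`. -/
def polytabloid (T : YoungTableau m lam) : (Fin m → ℕ) →₀ ℂ :=
  ∑ π ∈ T.colStab, Finsupp.single (T.act π).rowWord ((Equiv.Perm.sign π : ℤ) : ℂ)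

theorem wordRep_polytabloid (σ : Equiv.Perm (Fin m)) (T : YoungTableau m lam) :
    wordRep m σ T.polytabloid = (T.act σ).polytabloid := by
  simp only [polytabloid, map_sum]
  refine Finset.sum_bij' (fun π _ => σ * π * σ⁻¹) (fun π _ => σ⁻¹ * π * σ) ?_ ?_ ?_ ?_ ?_
  · intro π hπ
    simp only [colStab, Finset.mem_filter, Finset.mem_univ, true_and] at hπ ⊢
    intro k
    simpa [act] using hπ (σ⁻¹ k)
  · intro π hπ
    simp only [colStab, Finset.mem_filter, Finset.mem_univ, true_and] at hπ ⊢
    intro k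
    simpa [act] using hπ (σ k)
  · intro π _
    group
  · intro π _
    group
  · intro π _
    have h : (T.act π).rowWord ∘ ⇑σ⁻¹ = ((T.act σ).act (σ * π * σ⁻¹)).rowWord := by
      funext k
      change (T (π⁻¹ (σ⁻¹ k))).1.1 = (T (σ⁻¹ ((σ * π * σ⁻¹)⁻¹ k))).1.1
      simp
    have hs : Equiv.Perm.sign (σ * π * σ⁻¹) = Equiv.Perm.sign π := by
      rw [map_mul, map_mul, map_inv, mul_comm, inv_mul_cancel_left]
    rw [← h, hs]
    exact Finsupp.mapDomain_single

end YoungTableau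

/-- The Specht module `[lam]` for a partition `lam` of `m`: the span of the polytabloids of all
tableaux of shape `lam`, as a subrepresentation of the permutation representation on words. -/
def spechtModule (m : ℕ) (lam : YoungDiagram) : Subrepresentation (wordRep m) where
  toSubmodule := Submodule.span ℂ (Set.range fun T : YoungTableau m lam => T.polytabloid)
  apply_mem_toSubmodule σ v hv := by
    induction hv using Submodule.span_induction with
    | mem x hx =>
      obtain ⟨T, rfl⟩ := hx
      rw [YoungTableau.wordRep_polytabloid]
      exact Submodule.subset_span ⟨_, rfl⟩
    | zero => simp
    | add x y _ _ hx hy => rw [map_add]; exact add_mem hx hy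
    | smul a x _ hx => rw [map_smul]; exact Submodule.smul_mem _ _ hx

/-- The representation of `S_m` on the Specht module `[lam]`. -/
def spechtRep (m : ℕ) (lam : YoungDiagram) :
    Representation ℂ (Equiv.Perm (Fin m)) (spechtModule m lam).toSubmodule :=
  (spechtModule m lam).toRepresentation

/-- The tensor product `[lam 0] ⊗ ⋯ ⊗ [lam (d-1)]` with the diagonal action of `S_m`. -/
def spechtTensorRep {d : ℕ} (m : ℕ) (lam : Fin d → YoungDiagram) :
    Representation ℂ (Equiv.Perm (Fin m))
      (PiTensorProduct ℂ fun i => (spechtModule m (lam i)).toSubmodule) :=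
  PiTensorProduct.mapMonoidHom.comp (MonoidHom.pi fun i => spechtRep m (lam i))

/-- The generalized Kronecker coefficient `g(lam)` of a `d`-tuple of partitions of `m`: the
multiplicity of the trivial representation of `S_m` in the tensor product of the Specht modules
`[lam i]`, that is, the dimension of the space of `S_m`-equivariant linear maps from the former
to the latter. -/
def kroneckerCoeff {d : ℕ} (m : ℕ) (lam : Fin d → YoungDiagram) : ℕ :=
  Module.finrank ℂ (Representation.IntertwiningMap
    (Representation.trivial ℂ (Equiv.Perm (Fin m)) ℂ) (spechtTensorRep m lam))

end

/-! The multiplicities are realized as dimensions of subspaces of one integral domain. A `d`-tuple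
of words of length `m` is read position by position as a monomial of degree `m` in variables indexed
by `Fin d → ℕ`. The resulting map on tensors of words is constant on `S_m`-orbits. It is injective
on invariants, because the tuples giving one monomial form a single orbit. Hence `g(lam)` is the
dimension of the image `R(lam)` of the tensor product of Specht modules
(`kroneckerCoeff_eq_finrank_range`).

Multiplying polynomials corresponds to concatenating words. Concatenating two polytabloids gives the
polytabloid of the tableau whose columns are those of both, sorted by length; its shape is the sum
of the shapes (`YoungTableau.concat_polytabloid`). Therefore `R(lam) * R(mu) ≤ R(lam + mu)`, and
multiplication by a nonzero element of either factor embeds the other one into `R(lam + mu)`. -/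

open scoped TensorProduct

/-! ### Words, monomials and symmetrization -/

noncomputable section

/-- The content of a word: the number of occurrences of every letter. -/
def wordContent {A : Type*} {m : ℕ} (w : Fin m → A) : A →₀ ℕ :=
  ∑ k, Finsupp.single (w k) 1

theorem wordContent_comp_perm {A : Type*} {m : ℕ} (w : Fin m → A) (σ : Equiv.Perm (Fin m)) :
    wordContent (w ∘ σ) = wordContent w :=
  Equiv.sum_comp σ fun k => Finsupp.single (w k) 1

theorem wordContent_append {A : Type*} {m n : ℕ} (v : Fin m → A) (w : Fin n → A) :
    wordContent (Fin.append v w) = wordContent v + wordContent w := by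
  simp [wordContent, Fin.sum_univ_add]

theorem exists_perm_of_wordContent_eq {A : Type*} {m : ℕ} {v w : Fin m → A}
    (h : wordContent v = wordContent w) : ∃ σ : Equiv.Perm (Fin m), v = w ∘ σ := by
  classical
  have hcard (u : Fin m → A) (c : A) : wordContent u c = Fintype.card {k // u k = c} := by
    simp [wordContent, Finsupp.finsetSum_apply, Finsupp.single_apply, Fintype.card_subtype]
  have e (c : A) : {k // v k = c} ≃ {k // w k = c} :=
    Fintype.equivOfCardEq (by rw [← hcard, ← hcard, h])
  exact ⟨Equiv.ofFiberEquiv e, funext fun k => (Equiv.ofFiberEquiv_map e k).symm⟩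

/-- The word of letters `(w 0 k, …, w (d-1) k)` of a `d`-tuple of words. -/
def zipWords {d m : ℕ} (w : Fin d → Fin m → ℕ) : Fin m → Fin d → ℕ := fun k i => w i k

/-- The linear map that sends a `d`-tuple `w` of words to the monomial `∏ k, X (w · k)`. -/
def wordsToPoly (d m : ℕ) : ((Fin d → Fin m → ℕ) →₀ ℂ) →ₗ[ℂ] MvPolynomial (Fin d → ℕ) ℂ :=
  Finsupp.linearCombination ℂ fun w => MvPolynomial.monomial (wordContent (zipWords w)) 1

/-- Tensors of words as functions on `d`-tuples of words. -/
def tensorWords (d m : ℕ) :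
    (⨂[ℂ] _ : Fin d, (Fin m → ℕ) →₀ ℂ) ≃ₗ[ℂ] (Fin d → Fin m → ℕ) →₀ ℂ :=
  PiTensorProduct.ofFinsuppEquiv'

theorem tensorWords_tprod {d m : ℕ} (f : Fin d → (Fin m → ℕ) →₀ ℂ) (w : Fin d → Fin m → ℕ) :
    tensorWords d m (PiTensorProduct.tprod ℂ f) w = ∏ i, f i (w i) :=
  PiTensorProduct.ofFinsuppEquiv'_apply_apply _ _

theorem wordRep_apply {m : ℕ} (σ : Equiv.Perm (Fin m)) (f : (Fin m → ℕ) →₀ ℂ) (w : Fin m → ℕ) :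
    wordRep m σ f w = f (w ∘ σ) := by
  have hinj : Function.Injective fun u : Fin m → ℕ => u ∘ ⇑σ⁻¹ := fun u v h => by
    funext k
    simpa using congrFun h (σ k)
  have hw : w = (w ∘ σ) ∘ ⇑σ⁻¹ := by
    funext k
    simp
  conv_lhs => rw [hw]
  exact Finsupp.mapDomain_apply hinj f (w ∘ σ)

theorem tensorWords_map_wordRep {d m : ℕ} (σ : Equiv.Perm (Fin m))
    (x : ⨂[ℂ] _ : Fin d, (Fin m → ℕ) →₀ ℂ) (w : Fin d → Fin m → ℕ) :
    tensorWords d m (PiTensorProduct.map (fun _ => wordRep m σ) x) w =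
      tensorWords d m x fun i => w i ∘ σ := by
  induction x using PiTensorProduct.induction_on with
  | smul_tprod r f => simp [tensorWords_tprod, wordRep_apply]
  | add x y hx hy => simp [hx, hy]

/-- The simultaneous permutation of the positions of a `d`-tuple of words. -/
def permWords (d : ℕ) {m : ℕ} (σ : Equiv.Perm (Fin m)) : Equiv.Perm (Fin d → Fin m → ℕ) :=
  Equiv.piCongrRight fun _ => σ.arrowCongr (Equiv.refl ℕ)

theorem wordsToPoly_tensorWords_map {d m : ℕ} (σ : Equiv.Perm (Fin m))
    (x : ⨂[ℂ] _ : Fin d, (Fin m → ℕ) →₀ ℂ) :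
    wordsToPoly d m (tensorWords d m (PiTensorProduct.map (fun _ => wordRep m σ) x)) =
      wordsToPoly d m (tensorWords d m x) := by
  have h : tensorWords d m (PiTensorProduct.map (fun _ => wordRep m σ) x) =
      Finsupp.equivMapDomain (permWords d σ) (tensorWords d m x) := by
    ext w
    rw [tensorWords_map_wordRep, Finsupp.equivMapDomain_apply]
    rfl
  rw [h, Finsupp.equivMapDomain_eq_mapDomain, wordsToPoly, Finsupp.linearCombination_mapDomain]
  congr 2
  funext w
  have : zipWords (permWords d σ w) = zipWords w ∘ σ.symm := rfl
  simp only [Function.comp_apply, this, wordContent_comp_perm]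

/-- `F` is constant on the orbit of tuples sharing a monomial, so a coefficient is a value of `F`
times a count of tuples. In characteristic zero that count does not vanish when the value is
nonzero. -/
theorem eq_zero_of_wordsToPoly_eq_zero {d m : ℕ} {F : (Fin d → Fin m → ℕ) →₀ ℂ}
    (hF : ∀ (σ : Equiv.Perm (Fin m)) (w), F (fun i => w i ∘ σ) = F w)
    (h : wordsToPoly d m F = 0) : F = 0 := by
  classical
  ext w
  by_contra hw
  have hc := congrArg (MvPolynomial.coeff (wordContent (zipWords w))) h
  have hsum : MvPolynomial.coeff (wordContent (zipWords w)) (wordsToPoly d m F) =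
      ∑ v ∈ F.support, if wordContent (zipWords v) = wordContent (zipWords w) then F w else 0 := by
    rw [wordsToPoly, Finsupp.linearCombination_apply, Finsupp.sum, MvPolynomial.coeff_sum]
    refine Finset.sum_congr rfl fun v _ => ?_
    rw [MvPolynomial.coeff_smul, MvPolynomial.coeff_monomial]
    split_ifs with hv
    · obtain ⟨σ, hσ⟩ := exists_perm_of_wordContent_eq hv
      have : v = fun i => w i ∘ σ := by
        funext i k
        exact congrFun (congrFun hσ k) i
      rw [this, hF, smul_eq_mul, mul_one]
    · simp
  rw [hsum, MvPolynomial.coeff_zero, ← Finset.sum_filter, Finset.sum_const, nsmul_eq_mul,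
    mul_eq_zero, Nat.cast_eq_zero, Finset.card_eq_zero] at hc
  refine hc.elim (fun he => ?_) hw
  exact Finset.notMem_empty w (he ▸ Finset.mem_filter.2 ⟨Finsupp.mem_support_iff.2 hw, rfl⟩)

/-! ### Concatenation of words and multiplication of polynomials -/

/-- The external product of functions on `X` and `Y`, as a function on `Z ≃ X × Y`. -/
def extProd {X Y Z : Type*} (e : X × Y ≃ Z) : (X →₀ ℂ) →ₗ[ℂ] (Y →₀ ℂ) →ₗ[ℂ] Z →₀ ℂ :=
  (TensorProduct.mk ℂ (X →₀ ℂ) (Y →₀ ℂ)).compr₂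
    (finsuppTensorFinsupp' ℂ X Y ≪≫ₗ Finsupp.domLCongr e).toLinearMap

theorem extProd_apply {X Y Z : Type*} (e : X × Y ≃ Z) (f : X →₀ ℂ) (g : Y →₀ ℂ) (z : Z) :
    extProd e f g z = f (e.symm z).1 * g (e.symm z).2 := by
  simp [extProd, Finsupp.domLCongr_apply, Finsupp.domCongr_apply, Finsupp.equivMapDomain_apply,
    ← finsuppTensorFinsupp'_apply_apply]

theorem extProd_single {X Y Z : Type*} (e : X × Y ≃ Z) (x : X) (y : Y) (a b : ℂ) :
    extProd e (Finsupp.single x a) (Finsupp.single y b) = Finsupp.single (e (x, y)) (a * b) := by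
  rw [extProd, LinearMap.compr₂_apply, TensorProduct.mk_apply, LinearEquiv.coe_coe,
    LinearEquiv.trans_apply, finsuppTensorFinsupp'_single_tmul_single, Finsupp.domLCongr_single]

/-- The concatenation product on words. -/
def concat (m n : ℕ) :
    ((Fin m → ℕ) →₀ ℂ) →ₗ[ℂ] ((Fin n → ℕ) →₀ ℂ) →ₗ[ℂ] (Fin (m + n) → ℕ) →₀ ℂ :=
  extProd (Fin.appendEquiv m n)

/-- Coordinatewise concatenation of `d`-tuples of words. -/
def appendWords (d m n : ℕ) :
    (Fin d → Fin m → ℕ) × (Fin d → Fin n → ℕ) ≃ (Fin d → Fin (m + n) → ℕ) :=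
  (Equiv.arrowProdEquivProdArrow _ _ _).symm.trans
    (Equiv.piCongrRight fun _ => Fin.appendEquiv m n)

theorem zipWords_appendWords {d m n : ℕ} (v : Fin d → Fin m → ℕ) (w : Fin d → Fin n → ℕ) :
    zipWords (appendWords d m n (v, w)) = Fin.append (zipWords v) (zipWords w) := by
  funext k i
  refine Fin.addCases (fun a => ?_) (fun b => ?_) k
  · rw [Fin.append_left]
    exact Fin.append_left _ _ _
  · rw [Fin.append_right]
    exact Fin.append_right _ _ _

theorem wordsToPoly_extProd {d m n : ℕ} (F : (Fin d → Fin m → ℕ) →₀ ℂ)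
    (G : (Fin d → Fin n → ℕ) →₀ ℂ) :
    wordsToPoly d (m + n) (extProd (appendWords d m n) F G) =
      wordsToPoly d m F * wordsToPoly d n G := by
  have h : (extProd (appendWords d m n)).compr₂ (wordsToPoly d (m + n)) =
      (LinearMap.mul ℂ (MvPolynomial (Fin d → ℕ) ℂ)).compl₁₂
        (wordsToPoly d m) (wordsToPoly d n) := by
    ext v w : 4
    simp [extProd_single, wordsToPoly, zipWords_appendWords, wordContent_append,
      MvPolynomial.monomial_mul]
  exact LinearMap.congr_fun₂ h F G

theorem tensorWords_tprod_concat {d m n : ℕ} (f : Fin d → (Fin m → ℕ) →₀ ℂ)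
    (g : Fin d → (Fin n → ℕ) →₀ ℂ) :
    tensorWords d (m + n) (PiTensorProduct.tprod ℂ fun i => concat m n (f i) (g i)) =
      extProd (appendWords d m n) (tensorWords d m (PiTensorProduct.tprod ℂ f))
        (tensorWords d n (PiTensorProduct.tprod ℂ g)) := by
  ext w
  rw [extProd_apply]
  simp only [tensorWords_tprod, concat, extProd_apply, Finset.prod_mul_distrib]
  rfl

end

/-! ### Merging the columns of two diagrams -/

noncomputable section

/-- The cell of `lam.addRows mu` in which a cell of `lam` or of `mu` lands when the columns of
`lam` and `mu` are merged by decreasing length, those of `lam` first. -/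
def YoungDiagram.mergeCell (lam mu : YoungDiagram) : lam.cells ⊕ mu.cells → ℕ × ℕ :=
  -- `rowLen i` counts the columns longer than `i`. A column of `lam` is shifted past the strictly
  -- longer columns of `mu`; a column of `mu` is shifted past the columns of `lam` of at least its
  -- length, whence the `- 1`.
  Sum.elim (fun c => (c.1.1, c.1.2 + mu.rowLen (lam.colLen c.1.2)))
    fun c => (c.1.1, c.1.2 + lam.rowLen (mu.colLen c.1.2 - 1))

theorem YoungDiagram.mergeCell_mem (lam mu : YoungDiagram) (x : lam.cells ⊕ mu.cells) :
    lam.mergeCell mu x ∈ (lam.addRows mu).cells := by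
  rw [YoungDiagram.mem_cells, YoungDiagram.mem_addRows]
  rcases x with ⟨⟨i, j⟩, h⟩ | ⟨⟨i, j⟩, h⟩
  · have h1 := YoungDiagram.mem_iff_lt_rowLen.1 ((YoungDiagram.mem_cells _).1 h)
    have h2 := YoungDiagram.mem_iff_lt_colLen.1 ((YoungDiagram.mem_cells _).1 h)
    have h3 := mu.rowLen_anti _ _ h2.le
    simp only [mergeCell, Sum.elim_inl]
    omega
  · have h1 := YoungDiagram.mem_iff_lt_rowLen.1 ((YoungDiagram.mem_cells _).1 h)
    have h2 := YoungDiagram.mem_iff_lt_colLen.1 ((YoungDiagram.mem_cells _).1 h)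
    have h3 := lam.rowLen_anti i (mu.colLen j - 1) (by omega)
    simp only [mergeCell, Sum.elim_inr]
    omega

theorem YoungDiagram.lt_rowLen_iff_lt_colLen (lam : YoungDiagram) {i j : ℕ} :
    j < lam.rowLen i ↔ i < lam.colLen j :=
  YoungDiagram.mem_iff_lt_rowLen.symm.trans YoungDiagram.mem_iff_lt_colLen

theorem YoungDiagram.mergeCell_inl_col (lam mu : YoungDiagram) (c c' : lam.cells) :
    (lam.mergeCell mu (.inl c)).2 = (lam.mergeCell mu (.inl c')).2 ↔ c.1.2 = c'.1.2 := by
  have key : StrictMono fun j => j + mu.rowLen (lam.colLen j) := fun j j' h =>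
    add_lt_add_of_lt_of_le h (mu.rowLen_anti _ _ (lam.colLen_anti _ _ h.le))
  simp only [mergeCell, Sum.elim_inl]
  exact key.injective.eq_iff

theorem YoungDiagram.mergeCell_inr_col (lam mu : YoungDiagram) (c c' : mu.cells) :
    (lam.mergeCell mu (.inr c)).2 = (lam.mergeCell mu (.inr c')).2 ↔ c.1.2 = c'.1.2 := by
  have key : StrictMono fun j => j + lam.rowLen (mu.colLen j - 1) := fun j j' h =>
    add_lt_add_of_lt_of_le h
      (lam.rowLen_anti _ _ (Nat.sub_le_sub_right (mu.colLen_anti _ _ h.le) 1))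
  simp only [mergeCell, Sum.elim_inr]
  exact key.injective.eq_iff

/-- Of two columns, one from each diagram, exactly one precedes the other in the merging order. The
equivalences `a` and `b` turn this into a strict inequality of positions. -/
theorem YoungDiagram.mergeCell_inl_col_ne_inr (lam mu : YoungDiagram) (c : lam.cells)
    (c' : mu.cells) : (lam.mergeCell mu (.inl c)).2 ≠ (lam.mergeCell mu (.inr c')).2 := by
  obtain ⟨⟨i, j⟩, h⟩ := c
  obtain ⟨⟨i', j'⟩, h'⟩ := c'
  have h2 := YoungDiagram.mem_iff_lt_colLen.1 ((YoungDiagram.mem_cells _).1 h')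
  have a := lam.lt_rowLen_iff_lt_colLen (i := mu.colLen j' - 1) (j := j)
  have b := mu.lt_rowLen_iff_lt_colLen (i := lam.colLen j) (j := j')
  simp only [mergeCell, Sum.elim_inr, Sum.elim_inl]
  omega

theorem YoungDiagram.mergeCell_injective (lam mu : YoungDiagram) :
    Function.Injective (lam.mergeCell mu) := by
  rintro (c | c) (c' | c') h
  · exact congrArg _ (Subtype.ext (Prod.ext (Prod.ext_iff.1 h).1
      ((lam.mergeCell_inl_col mu c c').1 (congrArg Prod.snd h))))
  · exact (lam.mergeCell_inl_col_ne_inr mu c c' (congrArg Prod.snd h)).elim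
  · exact (lam.mergeCell_inl_col_ne_inr mu c' c (congrArg Prod.snd h).symm).elim
  · exact congrArg _ (Subtype.ext (Prod.ext (Prod.ext_iff.1 h).1
      ((lam.mergeCell_inr_col mu c c').1 (congrArg Prod.snd h))))

/-- Merging the columns of `lam` and `mu`, as a bijection of cells. -/
def YoungDiagram.mergeEquiv (lam mu : YoungDiagram) :
    lam.cells ⊕ mu.cells ≃ (lam.addRows mu).cells :=
  Equiv.ofBijective (fun x => ⟨lam.mergeCell mu x, lam.mergeCell_mem mu x⟩)
    ((Fintype.bijective_iff_injective_and_card _).2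
      ⟨fun _ _ h => lam.mergeCell_injective mu (congrArg Subtype.val h), by
        have := lam.card_addRows mu
        simp only [YoungDiagram.card] at this
        simp [this]⟩)

theorem YoungDiagram.coe_mergeEquiv (lam mu : YoungDiagram) (x : lam.cells ⊕ mu.cells) :
    (lam.mergeEquiv mu x : ℕ × ℕ) = lam.mergeCell mu x := rfl

/-! ### Joined tableaux and their column stabilizers -/

namespace YoungTableau

variable {m n : ℕ} {lam mu : YoungDiagram}

/-- The tableau of shape `lam.addRows mu` whose columns are those of `T` and those of `T'`, the
entries of the latter being shifted by `m`. -/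
def join (T : YoungTableau m lam) (T' : YoungTableau n mu) :
    YoungTableau (m + n) (lam.addRows mu) :=
  finSumFinEquiv.symm.trans ((Equiv.sumCongr T T').trans (lam.mergeEquiv mu))

/-- The permutation of `Fin (m + n)` that acts by `π` on the first `m` and by `ρ` on the last `n`
elements. -/
def blockPerm (π : Equiv.Perm (Fin m)) (ρ : Equiv.Perm (Fin n)) : Equiv.Perm (Fin (m + n)) :=
  finSumFinEquiv.permCongr (Equiv.Perm.sumCongr π ρ)

theorem blockPerm_castAdd (π : Equiv.Perm (Fin m)) (ρ : Equiv.Perm (Fin n)) (k : Fin m) :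
    blockPerm π ρ (Fin.castAdd n k) = Fin.castAdd n (π k) := by
  simp [blockPerm, Equiv.permCongr_apply]

theorem blockPerm_natAdd (π : Equiv.Perm (Fin m)) (ρ : Equiv.Perm (Fin n)) (k : Fin n) :
    blockPerm π ρ (Fin.natAdd m k) = Fin.natAdd m (ρ k) := by
  simp [blockPerm, Equiv.permCongr_apply]

theorem sign_blockPerm (π : Equiv.Perm (Fin m)) (ρ : Equiv.Perm (Fin n)) :
    Equiv.Perm.sign (blockPerm π ρ) = Equiv.Perm.sign π * Equiv.Perm.sign ρ := by
  rw [blockPerm, Equiv.Perm.sign_permCongr, Equiv.Perm.sign_sumCongr]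

theorem join_castAdd (T : YoungTableau m lam) (T' : YoungTableau n mu) (k : Fin m) :
    (T.join T' (Fin.castAdd n k)).1 = lam.mergeCell mu (.inl (T k)) := by
  simp [join, YoungDiagram.coe_mergeEquiv]

theorem join_natAdd (T : YoungTableau m lam) (T' : YoungTableau n mu) (k : Fin n) :
    (T.join T' (Fin.natAdd m k)).1 = lam.mergeCell mu (.inr (T' k)) := by
  simp [join, YoungDiagram.coe_mergeEquiv]

theorem mem_colStab {T : YoungTableau m lam} {π : Equiv.Perm (Fin m)} :
    π ∈ T.colStab ↔ ∀ k, (T (π k)).1.2 = (T k).1.2 := by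
  simp [colStab]

theorem blockPerm_mem_colStab (T : YoungTableau m lam) (T' : YoungTableau n mu)
    (π : Equiv.Perm (Fin m)) (ρ : Equiv.Perm (Fin n)) :
    blockPerm π ρ ∈ (T.join T').colStab ↔ π ∈ T.colStab ∧ ρ ∈ T'.colStab := by
  simp only [mem_colStab]
  constructor
  · refine fun h => ⟨fun k => ?_, fun k => ?_⟩
    · have := h (Fin.castAdd n k)
      rwa [blockPerm_castAdd, join_castAdd, join_castAdd, YoungDiagram.mergeCell_inl_col] at this
    · have := h (Fin.natAdd m k)
      rwa [blockPerm_natAdd, join_natAdd, join_natAdd, YoungDiagram.mergeCell_inr_col] at this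
  · rintro ⟨h1, h2⟩ k
    refine Fin.addCases (fun a => ?_) (fun b => ?_) k
    · rw [blockPerm_castAdd, join_castAdd, join_castAdd, YoungDiagram.mergeCell_inl_col]
      exact h1 a
    · rw [blockPerm_natAdd, join_natAdd, join_natAdd, YoungDiagram.mergeCell_inr_col]
      exact h2 b

theorem blockPerm_injective {π π' : Equiv.Perm (Fin m)} {ρ ρ' : Equiv.Perm (Fin n)}
    (h : blockPerm π ρ = blockPerm π' ρ') : π = π' ∧ ρ = ρ' := by
  have := Equiv.Perm.sumCongrHom_injective (a₁ := (π, ρ)) (a₂ := (π', ρ'))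
    (finSumFinEquiv.permCongr.injective h)
  exact Prod.mk.inj this

/-- No column of the joined tableau mixes entries of `T` and `T'`, so `τ` preserves the first block
and, by finiteness, also its complement. -/
theorem exists_eq_blockPerm {T : YoungTableau m lam} {T' : YoungTableau n mu}
    {τ : Equiv.Perm (Fin (m + n))} (hτ : τ ∈ (T.join T').colStab) :
    ∃ π ρ, τ = blockPerm π ρ := by
  rw [mem_colStab] at hτ
  have hmaps : Set.MapsTo (finSumFinEquiv.symm.permCongr τ)
      (Set.range (Sum.inl : Fin m → Fin m ⊕ Fin n)) (Set.range Sum.inl) := by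
    rintro _ ⟨k, rfl⟩
    have hk := hτ (Fin.castAdd n k)
    rw [Equiv.permCongr_apply]
    simp only [Equiv.symm_symm, finSumFinEquiv_apply_left]
    generalize τ (Fin.castAdd n k) = l at hk
    induction l using Fin.addCases with
    | left a => exact ⟨a, by simp⟩
    | right b =>
      rw [join_castAdd, join_natAdd] at hk
      exact (lam.mergeCell_inl_col_ne_inr mu _ _ hk.symm).elim
  obtain ⟨⟨π, ρ⟩, h⟩ := Equiv.Perm.mem_sumCongrHom_range_of_perm_mapsTo_inl hmaps
  refine ⟨π, ρ, finSumFinEquiv.symm.permCongr.injective (h.symm.trans ?_)⟩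
  ext x
  simp [blockPerm, Equiv.permCongr_apply, Equiv.Perm.sumCongrHom_apply]

theorem rowWord_act_join (T : YoungTableau m lam) (T' : YoungTableau n mu)
    (π : Equiv.Perm (Fin m)) (ρ : Equiv.Perm (Fin n)) :
    ((T.join T').act (blockPerm π ρ)).rowWord =
      Fin.append (T.act π).rowWord (T'.act ρ).rowWord := by
  have h (k) : ((T.join T').act (blockPerm π ρ)).rowWord k =
      (T.join T' (blockPerm π⁻¹ ρ⁻¹ k)).1.1 := rfl
  funext k
  rw [h]
  refine Fin.addCases (fun a => ?_) (fun b => ?_) k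
  · rw [blockPerm_castAdd, join_castAdd, Fin.append_left]
    rfl
  · rw [blockPerm_natAdd, join_natAdd, Fin.append_right]
    rfl

end YoungTableau

end

/-! ### Kronecker coefficients as dimensions of spaces of polynomials -/

noncomputable section

/-- The column stabilizer of the join is the product of the two stabilizers, signs multiply, and
merging columns leaves the row of each entry unchanged. -/
theorem YoungTableau.concat_polytabloid {m n : ℕ} {lam mu : YoungDiagram}
    (T : YoungTableau m lam) (T' : YoungTableau n mu) :
    concat m n T.polytabloid T'.polytabloid = (T.join T').polytabloid := by
  simp only [polytabloid, map_sum, LinearMap.sum_apply]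
  rw [Finset.sum_comm, ← Finset.sum_product']
  refine Finset.sum_bij (fun p _ => blockPerm p.1 p.2) ?_ ?_ ?_ ?_
  · intro p hp
    exact (blockPerm_mem_colStab T T' _ _).2 (Finset.mem_product.1 hp)
  · intro p _ q _ h
    exact Prod.ext (blockPerm_injective h).1 (blockPerm_injective h).2
  · intro τ hτ
    obtain ⟨π, ρ, rfl⟩ := exists_eq_blockPerm hτ
    exact ⟨(π, ρ), Finset.mem_product.2 ((blockPerm_mem_colStab T T' _ _).1 hτ), rfl⟩
  · intro p _
    rw [concat, extProd_single, rowWord_act_join, sign_blockPerm]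
    push_cast
    rfl

theorem concat_mem_spechtModule {m n : ℕ} {lam mu : YoungDiagram}
    {f : (Fin m → ℕ) →₀ ℂ} (hf : f ∈ (spechtModule m lam).toSubmodule)
    {g : (Fin n → ℕ) →₀ ℂ} (hg : g ∈ (spechtModule n mu).toSubmodule) :
    concat m n f g ∈ (spechtModule (m + n) (lam.addRows mu)).toSubmodule := by
  have h := Submodule.apply_mem_map₂ (concat m n) hf hg
  simp only [spechtModule, Submodule.map₂_span_span] at h
  refine Submodule.span_mono ?_ h
  rintro _ ⟨_, ⟨T, rfl⟩, _, ⟨T', rfl⟩, rfl⟩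
  exact ⟨T.join T', (T.concat_polytabloid T').symm⟩

/-- If a linear map is constant on orbits of a finite group and injective on invariants, then its
rank is the multiplicity of the trivial representation. -/
theorem finrank_intertwiningMap_trivial {G V P : Type*} [Group G] [Finite G] [AddCommMonoid V]
    [Module ℂ V] [AddCommGroup P] [Module ℂ P] (ρ : Representation ℂ G V) (θ : V →ₗ[ℂ] P)
    (hθ : ∀ g v, θ (ρ g v) = θ v) 
    (hinj : ∀ v w, (∀ g, ρ g v = v) → (∀ g, ρ g w = w) → θ v = θ w → v = w) :
    Module.finrank ℂ (Representation.IntertwiningMap (Representation.trivial ℂ G ℂ) ρ) =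
      Module.finrank ℂ (LinearMap.range θ) := by
  -- An intertwiner out of the trivial representation amounts to an invariant vector, its value at
  -- `1`.
  let E : Representation.IntertwiningMap (Representation.trivial ℂ G ℂ) ρ →ₗ[ℂ] P :=
    { toFun := fun f => θ (f 1)
      map_add' := fun f g => map_add θ (f 1) (g 1)
      map_smul' := fun c f => map_smul θ c (f 1) }
  have hE : Function.Injective E := by
    intro f f' hf
    have h1 : f 1 = f' 1 := hinj _ _
      (fun g => (Representation.IntertwiningMap.isIntertwining _ _ f g 1).symm)
      (fun g => (Representation.IntertwiningMap.isIntertwining _ _ f' g 1).symm) hf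
    ext
    exact h1
  have hrange : LinearMap.range E = LinearMap.range θ := by
    refine le_antisymm ?_ ?_
    · rintro _ ⟨f, rfl⟩
      exact ⟨f 1, rfl⟩
    · rintro _ ⟨v, rfl⟩
      have := Fintype.ofFinite G
      have hcard : (Fintype.card G : ℂ) ≠ 0 := Nat.cast_ne_zero.2 Fintype.card_ne_zero
      -- The average of the orbit of `v` is invariant and has the same image under `θ` as `v`.
      let u : V := (Fintype.card G : ℂ)⁻¹ • ∑ g, ρ g v
      have hu (g : G) : ρ g u = u := by
        simp only [u, map_smul, map_sum, ← Module.End.mul_apply, ← map_mul]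
        rw [Fintype.sum_equiv (Equiv.mulLeft g) (fun x => ρ (g * x) v) (fun x => ρ x v)
          fun _ => rfl]
      refine ⟨⟨LinearMap.toSpanSingleton ℂ V u, fun g => ?_⟩, ?_⟩
      · ext
        simp [hu]
      · change θ ((1 : ℂ) • u) = θ v
        rw [one_smul]
        simp only [u, map_smul, map_sum, hθ, Finset.sum_const, Finset.card_univ,
          ← Nat.cast_smul_eq_nsmul ℂ, smul_smul, inv_mul_cancel₀ hcard, one_smul]
  rw [← hrange]
  exact (LinearEquiv.ofInjective E hE).finrank_eq

/-- The symmetrization map from a tensor product of Specht modules to polynomials. -/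
def spechtToPoly {d : ℕ} (m : ℕ) (lam : Fin d → YoungDiagram) :
    (⨂[ℂ] i, (spechtModule m (lam i)).toSubmodule) →ₗ[ℂ] MvPolynomial (Fin d → ℕ) ℂ :=
  wordsToPoly d m ∘ₗ (tensorWords d m).toLinearMap ∘ₗ
    PiTensorProduct.map fun i => (spechtModule m (lam i)).toSubmodule.subtype

theorem spechtToPoly_tprod {d m : ℕ} (lam : Fin d → YoungDiagram)
    (f : ∀ i, (spechtModule m (lam i)).toSubmodule) :
    spechtToPoly m lam (PiTensorProduct.tprod ℂ f) =
      wordsToPoly d m (tensorWords d m (PiTensorProduct.tprod ℂ fun i => (f i : _ →₀ ℂ))) := by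
  simp [spechtToPoly, PiTensorProduct.map_tprod]

/-- Over a field every inclusion has a linear retraction, and the tensor product of the retractions
is a left inverse. -/
theorem PiTensorProduct.map_subtype_injective {ι K : Type*} [Field K] {V : ι → Type*}
    [∀ i, AddCommGroup (V i)] [∀ i, Module K (V i)] (S : ∀ i, Submodule K (V i)) :
    Function.Injective (PiTensorProduct.map fun i => (S i).subtype) := by
  choose p hp using fun i => (S i).subtype.exists_leftInverse_of_injective (S i).ker_subtype
  refine Function.LeftInverse.injective (g := PiTensorProduct.map p) fun x => ?_
  rw [← LinearMap.comp_apply, ← PiTensorProduct.map_comp]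
  simp only [hp, PiTensorProduct.map_id, LinearMap.id_apply]

theorem map_subtype_spechtTensorRep {d m : ℕ} (lam : Fin d → YoungDiagram)
    (σ : Equiv.Perm (Fin m)) (x : ⨂[ℂ] i, (spechtModule m (lam i)).toSubmodule) :
    PiTensorProduct.map (fun i => (spechtModule m (lam i)).toSubmodule.subtype)
        (spechtTensorRep m lam σ x) =
      PiTensorProduct.map (fun _ => wordRep m σ)
        (PiTensorProduct.map (fun i => (spechtModule m (lam i)).toSubmodule.subtype) x) := by
  change PiTensorProduct.map _ (PiTensorProduct.map (fun i => spechtRep m (lam i) σ) x) = _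
  rw [← LinearMap.comp_apply, ← LinearMap.comp_apply, ← PiTensorProduct.map_comp,
    ← PiTensorProduct.map_comp]
  rfl

theorem kroneckerCoeff_eq_finrank_range {d m : ℕ} (lam : Fin d → YoungDiagram) :
    kroneckerCoeff m lam = Module.finrank ℂ (LinearMap.range (spechtToPoly m lam)) := by
  refine finrank_intertwiningMap_trivial (spechtTensorRep m lam) _ (fun σ x => ?_) fun x y hx hy h => ?_
  · simp only [spechtToPoly, LinearMap.comp_apply, LinearEquiv.coe_coe,
      map_subtype_spechtTensorRep, wordsToPoly_tensorWords_map]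
  · refine PiTensorProduct.map_subtype_injective _ ((tensorWords d m).injective ?_)
    rw [← sub_eq_zero]
    refine eq_zero_of_wordsToPoly_eq_zero (fun σ w => ?_) ((map_sub _ _ _).trans (sub_eq_zero.2 h))
    simp only [Finsupp.sub_apply]
    rw [← tensorWords_map_wordRep, ← tensorWords_map_wordRep, ← map_subtype_spechtTensorRep,
      ← map_subtype_spechtTensorRep, hx σ, hy σ]

/-- By bilinearity pure tensors suffice; there the preimage of the product is the tensor of the
coordinatewise concatenations. -/
theorem range_spechtToPoly_mul_le {d m n : ℕ} (lam mu : Fin d → YoungDiagram) :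
    LinearMap.range (spechtToPoly m lam) * LinearMap.range (spechtToPoly n mu) ≤
      LinearMap.range (spechtToPoly (m + n) fun i => (lam i).addRows (mu i)) := by
  simp only [← Submodule.map_top (spechtToPoly m lam), ← Submodule.map_top (spechtToPoly n mu),
    ← PiTensorProduct.span_tprod_eq_top, Submodule.map_span]
  rw [Submodule.span_mul_span, Submodule.span_le]
  rintro _ ⟨_, ⟨_, ⟨f, rfl⟩, rfl⟩, _, ⟨_, ⟨g, rfl⟩, rfl⟩, rfl⟩
  refine ⟨PiTensorProduct.tprod ℂ fun i =>
    ⟨concat m n (f i) (g i), concat_mem_spechtModule (f i).2 (g i).2⟩, ?_⟩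
  simp only [spechtToPoly_tprod, tensorWords_tprod_concat, wordsToPoly_extProd]

theorem finiteDimensional_range_spechtToPoly {d m : ℕ} (lam : Fin d → YoungDiagram) :
    FiniteDimensional ℂ (LinearMap.range (spechtToPoly m lam)) := by
  have (i : Fin d) : FiniteDimensional ℂ (spechtModule m (lam i)).toSubmodule :=
    FiniteDimensional.span_of_finite ℂ (Set.finite_range _)
  have := PiTensorProduct.finite (R := ℂ) (M := fun i => (spechtModule m (lam i)).toSubmodule)
  exact Module.Finite.range _

/-- In a domain, multiplication by a nonzero `v ∈ V` is an injection of `U` into `W`. Finite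
dimension of `W` matters, since `finrank` is `0` on infinite-dimensional spaces. -/
theorem Submodule.finrank_le_of_mul_le {K A : Type*} [Field K] [CommRing A] [IsDomain A]
    [Algebra K A] {U V W : Submodule K A} [FiniteDimensional K W] (h : U * V ≤ W)
    (hV : 0 < Module.finrank K V) : Module.finrank K U ≤ Module.finrank K W := by
  obtain ⟨v, hv, hv0⟩ := V.ne_bot_iff.1 (by rintro rfl; simp at hV)
  let f : U →ₗ[K] W := ((LinearMap.mulRight K v).restrict fun u hu => h (mul_mem_mul hu hv))
  refine LinearMap.finrank_le_finrank_of_injective (f := f) fun a b hab => Subtype.ext ?_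
  exact mul_right_cancel₀ hv0 (congrArg Subtype.val hab)

end

theorem mainTheorem10 (d m₁ m₂ : ℕ) (lam mu : Fin d → YoungDiagram)
    (hlam : ∀ i, (lam i).card = m₁) (hmu : ∀ i, (mu i).card = m₂)
    (hpos : 0 < kroneckerCoeff m₁ lam * kroneckerCoeff m₂ mu) :
    max (kroneckerCoeff m₁ lam) (kroneckerCoeff m₂ mu) ≤
      kroneckerCoeff (m₁ + m₂) (fun i => (lam i).addRows (mu i)) := by
  have h1 := Nat.pos_of_mul_pos_right hpos
  have h2 := Nat.pos_of_mul_pos_left hpos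
  simp only [kroneckerCoeff_eq_finrank_range] at h1 h2 ⊢
  have := finiteDimensional_range_spechtToPoly (m := m₁ + m₂) fun i => (lam i).addRows (mu i)
  have h := range_spechtToPoly_mul_le (m := m₁) (n := m₂) lam mu
  exact max_le (Submodule.finrank_le_of_mul_le h (by assumption))
    (Submodule.finrank_le_of_mul_le ((mul_comm _ _).trans_le h) (by assumption))
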